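/- Let $V$ be a finite set with $|V|=n$, let $q$ be a positive integer, and let $\mu$ be a probability distribution over $[q]^V$ whose support $\Omega=\{\tau\in[q]^V:\mu(\tau)>0\}$ has at least two elements. For $\Lambda\subseteq V$, call a partial configuration $\sigma\in[q]^{\Lambda}$ feasible if it extends to some $\tau\in\Omega$. For feasible $\sigma\in[q]^\Lambda$ and $u\in V\setminus\Lambda$, let $\mu_u^{\sigma}$ be the marginal distribution on $u$ of $\mu$ conditioned on $X_\Lambda=\sigma$, let $\Omega_u^\sigma=\{i\in[q]:\mu_u^\sigma(i)>0\}$, and, for $v\in V\setminus\Lambda$ and $i\in\Omega_u^\sigma$, let $\mu_v^{\sigma,u\leftarrow i}$ be the marginal distribution on $v$ of $\mu$ conditioned on $X_\Lambda=\sigma$ and $X_u=i$. The influence matrix $\Psi_\mu^\sigma\in\mathbb R^{(V\setminus\Lambda)\times(V\setminus\Lambda)}$ is defined by $$\Psi_\mu^\sigma(u,v)=\max_{i,j\in\Omega_u^\sigma} d_{\mathrm{TV}}\bigl(\mu_v^{\sigma,u\leftarrow i},\mu_v^{\sigma,u\leftarrow j}\bigr)\quad(u\ne v),\qquad \Psi_\mu^\sigma(u,u)=0,$$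 where $d_{\mathrm{TV}}(p,p')=\frac12\sum_{c\in[q]}|p(c)-p'(c)|$. Let $\rho$ denote the spectral radius (largest modulus of a complex eigenvalue). Let $\eta_0,\dots,\eta_{n-2}$ be real numbers with $0\le\eta_k<n-k-1$ for all $0\le k\le n-2$, and suppose that $\mu$ is $(\eta_0,\dots,\eta_{n-2})$-spectrally independent, i.e. $\rho(\Psi_\mu^{\sigma})\le\eta_k$ for every $0\le k\le n-2$, every $\Lambda\subseteq V$ with $|\Lambda|=k$ and every feasible $\sigma\in[q]^\Lambda$. Let $P$ be the transition matrix on $\Omega$ of the Glauber dynamics for $\mu$: in each step choose $v\in V$ uniformly at random and resample the value of $v$ from its marginal distribution under $\mu$ conditioned on the current values of all other variables. Then all eigenvalues of $P$ are real, and its second largest eigenvalue $\lambda_2(P)$ (counted with multiplicity) satisfies $$1-\lambda_2(P)\ \ge\ \frac1n\prod_{k=0}^{n-2}\Bigl(1-\frac{\eta_k}{n-k-1}\Bigr).$$ -/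

import Mathlib

namespace SpectralIndependence

noncomputable section

variable {V : Type*} [Fintype V] [DecidableEq V] {q : ℕ}

/-- Full configurations in `[q]^V`. -/
abbrev Config (V : Type*) (q : ℕ) : Type _ := V → Fin q

/-- The support `Ω` of a distribution `μ` (given by its mass function) over `[q]^V`. -/
abbrev Supp (μ : Config V q → ℝ) : Type _ := {τ : Config V q // 0 < μ τ}

/-- The probability of the event `E` under the mass function `μ`. -/
def prob (μ : Config V q → ℝ) (E : Set (Config V q)) : ℝ :=
  ∑ τ, E.indicator μ τ

/-- The marginal distribution on `v` of `μ` conditioned on the event `E`: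
`c ↦ Pr[X_v = c | X ∈ E]` (meaningful when `E` has positive probability). -/
def condMarginal (μ : Config V q → ℝ) (E : Set (Config V q)) (v : V) (c : Fin q) : ℝ :=
  prob μ (E ∩ {τ | τ v = c}) / prob μ E

/-- The total variation distance between two mass functions on `[q]`. -/
def tvDist (p p' : Fin q → ℝ) : ℝ :=
  (1 / 2) * ∑ c, |p c - p' c|

/-- The event `X_Λ = σ` for a partial configuration `σ ∈ [q]^Λ`. -/
def cylinder {Λ : Finset V} (σ : Λ → Fin q) : Set (Config V q) :=
  {τ | ∀ w : Λ, τ w = σ w}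

/-- A partial configuration is feasible if it extends to a configuration of positive mass. -/
def Feasible (μ : Config V q → ℝ) {Λ : Finset V} (σ : Λ → Fin q) : Prop :=
  ∃ τ ∈ cylinder σ, 0 < μ τ

/-- The set `Ω_u^σ` of possible values of `u` given `σ`. -/
def possibleValues (μ : Config V q → ℝ) {Λ : Finset V} (σ : Λ → Fin q) (u : V) :
    Set (Fin q) :=
  {i | 0 < condMarginal μ (cylinder σ) u i}

/-- The pairwise influence matrix `Ψ_μ^σ`, indexed by `V \ Λ`. For distinct `u`, `v` the entry is
the maximum, over `i, j ∈ Ω_u^σ`, of the total variation distance between the marginals on `v`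
conditioned on `σ` together with `u ← i`, respectively `u ← j`; the diagonal is zero. -/
def influenceMatrix (μ : Config V q → ℝ) {Λ : Finset V} (σ : Λ → Fin q) :
    Matrix {v : V // v ∉ Λ} {v : V // v ∉ Λ} ℝ :=
  Matrix.of fun u v =>
    if u = v then 0
    else ⨆ p : possibleValues μ σ u.1 × possibleValues μ σ u.1,
      tvDist (condMarginal μ (cylinder σ ∩ {τ | τ u.1 = p.1.1}) v.1)
        (condMarginal μ (cylinder σ ∩ {τ | τ u.1 = p.2.1}) v.1)

/-- The spectral radius `ρ(A)` of a real square matrix: the largest modulus of a complex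
eigenvalue. -/
def rho {ι : Type*} [Fintype ι] [DecidableEq ι] (A : Matrix ι ι ℝ) : ℝ :=
  (spectralRadius ℂ (A.map Complex.ofReal)).toReal

/-- `μ` is `(η_0, …, η_{n-2})`-spectrally independent, where `n = |V|`
(only the values `η k` with `k + 2 ≤ n` matter). -/
def IsSpectrallyIndependent (μ : Config V q → ℝ) (η : ℕ → ℝ) : Prop :=
  ∀ k : ℕ, k + 2 ≤ Fintype.card V → ∀ Λ : Finset V, Λ.card = k →
    ∀ σ : Λ → Fin q, Feasible μ σ → rho (influenceMatrix μ σ) ≤ η k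

/-- The transition matrix of the Glauber dynamics on the support of `μ`: choose `v ∈ V`
uniformly at random and resample its value from the marginal of `μ` on `v` conditioned on the
current values of all other variables. -/
def glauber (μ : Config V q → ℝ) : Matrix (Supp μ) (Supp μ) ℝ :=
  Matrix.of fun x y =>
    (1 / (Fintype.card V : ℝ)) * ∑ v : V,
      if ∀ w, w ≠ v → y.1 w = x.1 w then
        condMarginal μ {τ | ∀ w, w ≠ v → τ w = x.1 w} v (y.1 v)
      else 0

/-- The real eigenvalues of a real square matrix, listed with algebraic multiplicity in
decreasing order. -/
def eigenvalueList {ι : Type*} [Fintype ι] [DecidableEq ι] (A : Matrix ι ι ℝ) : List ℝ :=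
  A.charpoly.roots.sort (· ≥ ·)

/-- The second largest eigenvalue, counted with multiplicity (meaningful when all eigenvalues
are real and there are at least two of them). -/
def lambda2 {ι : Type*} [Fintype ι] [DecidableEq ι] (A : Matrix ι ι ℝ) : ℝ :=
  (eigenvalueList A).getD 1 0

end

end SpectralIndependence

/-! The proof is a local-to-global argument for conditional variances. For a set `Λ` of coordinates
let `E_Λ` be conditional expectation given `X_Λ`, acting on functions on the support, and let
`energy` be the expected conditional variance given `X_Λ`. The Glauber matrix is the average over
`v` of `E_{V∖v}`, so its Dirichlet form is `1/n` times the sum of the energies given all coordinates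
but one (`sum_mul_glauber`). It remains to bound this sum below by the variance, which is the energy
at `Λ = ∅`.

One coordinate is revealed at a time. With `k` the size of `Λ`, the sum of the energies given `Λ ∪
{u}` over `u ∉ Λ` is at least `n - k - 1 - η_k` times the energy given `Λ`
(`sub_mul_energy_le_sum_energy_insert`). Iterating, each final coordinate is counted `n - k - 1`
times at level `k`; dividing by this gives the factor `1 - η_k / (n - k - 1)`
(`prod_mul_energy_le`).

Spectral independence enters in `eigenvalue_sum_condExp_le`. If `E_Λ f = 0` and `∑_u E_{Λ∪u} f = t
f`, put `g_u = E_{Λ∪u} f`. Applying `E_{Λ∪u}` gives `t g_u = g_u + ∑_{v≠u} E_{Λ∪u} g_v`. Once `X_Λ`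
is fixed, `g_v` depends on coordinate `v` only, so the oscillation of `E_{Λ∪u} g_v` is at most
`Ψ(u,v)` times that of `g_v`. The vector `o` of oscillations thus satisfies `(t - 1) o ≤ Ψ o`, and
Collatz–Wielandt gives `t - 1 ≤ ρ(Ψ) ≤ η`. -/

namespace SpectralIndependence

open Matrix

/-! ### Reversible matrices: quadratic forms and the second eigenvalue. -/

section WeightedSymmetric

variable {ι : Type*}

/-- The conjugate of `K` by `diag √w`. It is symmetric when `K` is reversible with respect
to `w`. -/
noncomputable def symmetrize (w : ι → ℝ) (K : Matrix ι ι ℝ) : Matrix ι ι ℝ :=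
  Matrix.of fun x y => √(w x) * K x y / √(w y)

theorem symmetrize_isHermitian {w : ι → ℝ} (hw : ∀ x, 0 < w x) {K : Matrix ι ι ℝ}
    (hK : ∀ x y, w x * K x y = w y * K y x) : (symmetrize w K).IsHermitian := by
  ext x y
  have hx := Real.sqrt_pos.2 (hw x)
  have hy := Real.sqrt_pos.2 (hw y)
  have h := hK x y
  rw [← Real.mul_self_sqrt (hw x).le, ← Real.mul_self_sqrt (hw y).le] at h
  simp only [conjTranspose_apply, symmetrize, of_apply, star_trivial]
  rw [div_eq_div_iff hx.ne' hy.ne']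
  linarith

theorem symmetrize_mulVec [Fintype ι] {w : ι → ℝ} (hw : ∀ x, 0 < w x)
    (K : Matrix ι ι ℝ) (f : ι → ℝ) :
    symmetrize w K *ᵥ (fun x => √(w x) * f x) = fun x => √(w x) * (K *ᵥ f) x := by
  ext x
  simp only [mulVec, dotProduct, symmetrize, of_apply, Finset.mul_sum]
  refine Finset.sum_congr rfl fun y _ => ?_
  have hy := Real.sqrt_pos.2 (hw y)
  field_simp

theorem exists_eq_sqrt_mul {w : ι → ℝ} (hw : ∀ x, 0 < w x) (g : ι → ℝ) :
    ∃ f : ι → ℝ, g = fun x => √(w x) * f x :=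
  ⟨fun x => g x / √(w x), by
    ext x; have := Real.sqrt_pos.2 (hw x); field_simp⟩

theorem symmetrize_charpoly [Fintype ι] [DecidableEq ι] {w : ι → ℝ} (hw : ∀ x, 0 < w x)
    (K : Matrix ι ι ℝ) :
    (symmetrize w K).charpoly = K.charpoly := by
  have hs : ∀ x, √(w x) ≠ 0 := fun x => (Real.sqrt_pos.2 (hw x)).ne'
  let M : (Matrix ι ι ℝ)ˣ :=
    ⟨diagonal fun x => √(w x), diagonal fun x => (√(w x))⁻¹,
      by simp [diagonal_mul_diagonal, hs], by simp [diagonal_mul_diagonal, hs]⟩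
  rw [← charpoly_units_conj M K, ← coe_units_inv]
  congr 1
  change _ = diagonal (fun x => √(w x)) * K * diagonal (fun x => (√(w x))⁻¹)
  ext x y
  simp [symmetrize, div_eq_mul_inv]

theorem sqrt_dotProduct_sqrt [Fintype ι] {w : ι → ℝ} (hw : ∀ x, 0 < w x) (f g : ι → ℝ) :
    (fun x => √(w x) * f x) ⬝ᵥ (fun x => √(w x) * g x) = ∑ x, w x * (f x * g x) := by
  refine Finset.sum_congr rfl fun x _ => ?_
  linear_combination (f x * g x) * Real.mul_self_sqrt (hw x).le

/-- For a reversible matrix, an upper bound on the eigenvalues bounds the quadratic form. -/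
theorem form_le_of_eigenvalue_le [Fintype ι] [DecidableEq ι] {w : ι → ℝ}
    (hw : ∀ x, 0 < w x) {K : Matrix ι ι ℝ}
    (hK : ∀ x y, w x * K x y = w y * K y x) {c : ℝ}
    (hc : ∀ (t : ℝ) (f : ι → ℝ), f ≠ 0 → K *ᵥ f = t • f → t ≤ c) (f : ι → ℝ) :
    ∑ x, w x * (f x * (K *ᵥ f) x) ≤ c * ∑ x, w x * (f x * f x) := by
  have hS := symmetrize_isHermitian hw hK
  have hT : (c • (1 : Matrix ι ι ℝ) - symmetrize w K).IsHermitian :=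
    ((isHermitian_one).smul (IsSelfAdjoint.all c)).sub hS
  have hpos : (c • (1 : Matrix ι ι ℝ) - symmetrize w K).PosSemidef := by
    rw [hT.posSemidef_iff_eigenvalues_nonneg]
    intro i
    have h := hT.mulVec_eigenvectorBasis i
    have hne : (hT.eigenvectorBasis i : ι → ℝ) ≠ 0 :=
      (WithLp.ofLp_eq_zero 2).ne.2 <| hT.eigenvectorBasis.orthonormal.ne_zero i
    generalize (hT.eigenvectorBasis i : ι → ℝ) = g at h hne
    obtain ⟨f, rfl⟩ := exists_eq_sqrt_mul hw g
    rw [sub_mulVec, smul_mulVec, one_mulVec, symmetrize_mulVec hw] at h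
    have hf : f ≠ 0 := by
      rintro rfl
      exact hne (by ext; simp)
    -- An eigenvalue `s` of `c - symmetrize w K` corresponds to the eigenvalue `c - s` of `K`, so `c
    -- - s ≤ c` gives `s ≥ 0`.
    have := hc (c - hT.eigenvalues i) f hf (by
      ext x
      have hx := congrFun h x
      simp only [Pi.sub_apply, Pi.smul_apply, smul_eq_mul] at hx ⊢
      have := Real.sqrt_pos.2 (hw x)
      apply mul_left_cancel₀ this.ne'
      linarith)
    simp only [Pi.zero_apply]
    linarith
  have h := hpos.dotProduct_mulVec_nonneg (fun x => √(w x) * f x)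
  rw [star_trivial, sub_mulVec, smul_mulVec, one_mulVec, symmetrize_mulVec hw, dotProduct_sub,
    dotProduct_smul, sqrt_dotProduct_sqrt hw, sqrt_dotProduct_sqrt hw, smul_eq_mul] at h
  linarith

/-- A reversible matrix has real eigenvalues, and its second largest eigenvalue is at most any
bound for its quadratic form on functions of mean zero. -/
theorem lambda2_le_of_form_le [Fintype ι] [DecidableEq ι] {w : ι → ℝ}
    (hw : ∀ x, 0 < w x) {K : Matrix ι ι ℝ}
    (hK : ∀ x y, w x * K x y = w y * K y x) (hcard : 2 ≤ Fintype.card ι) {c : ℝ}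
    (hc : ∀ f : ι → ℝ, ∑ x, w x * f x = 0 →
      ∑ x, w x * (f x * (K *ᵥ f) x) ≤ c * ∑ x, w x * (f x * f x)) :
    K.charpoly.Splits ∧ lambda2 K ≤ c := by
  have hS := symmetrize_isHermitian hw hK
  refine ⟨symmetrize_charpoly hw K ▸ hS.splits_charpoly, ?_⟩
  let e : Fin (Fintype.card ι) ≃ ι := Fintype.equivOfCardEq (Fintype.card_fin _)
  let k₀ : Fin (Fintype.card ι) := ⟨0, by omega⟩
  let k₁ : Fin (Fintype.card ι) := ⟨1, by omega⟩
  have hk : k₀ ≠ k₁ := by simp [k₀, k₁]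
  have hl : lambda2 K = hS.eigenvalues₀ k₁ := by
    have h := hS.sort_roots_charpoly_eq_eigenvalues₀
    rw [symmetrize_charpoly hw] at h
    have hid : (RCLike.re : ℝ → ℝ) = id := by ext; simp
    rw [hid, Multiset.map_id] at h
    -- `hcard` puts index `1` in range, so the default value `0` is never taken.
    rw [lambda2, eigenvalueList, h, List.getD_eq_getElem _ _ (by simp; omega),
      List.getElem_ofFn]
  have hle : hS.eigenvalues₀ k₁ ≤ hS.eigenvalues₀ k₀ :=
    hS.eigenvalues₀_antitone (by simp [k₀, k₁, Fin.le_def])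
  have heig : ∀ k, hS.eigenvalues (e k) = hS.eigenvalues₀ k := fun k => by
    simp [IsHermitian.eigenvalues, e]
  have hd : ∀ i j, (hS.eigenvectorBasis i : ι → ℝ) ⬝ᵥ (hS.eigenvectorBasis j : ι → ℝ)
      = if i = j then 1 else 0 := fun i j => by
    have := (orthonormal_iff_ite.1 hS.eigenvectorBasis.orthonormal) j i
    rw [EuclideanSpace.inner_eq_star_dotProduct, star_trivial] at this
    rw [this]; simp [eq_comm]
  have h0 := hS.mulVec_eigenvectorBasis (e k₀)
  have h1 := hS.mulVec_eigenvectorBasis (e k₁)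
  have d00 := hd (e k₀) (e k₀)
  have d01 := hd (e k₀) (e k₁)
  have d10 := hd (e k₁) (e k₀)
  have d11 := hd (e k₁) (e k₁)
  rw [heig] at h0 h1
  simp only [e.injective.eq_iff, hk, hk.symm, if_true, if_false] at d00 d01 d10 d11
  generalize (hS.eigenvectorBasis (e k₀) : ι → ℝ) = v₀ at *
  generalize (hS.eigenvectorBasis (e k₁) : ι → ℝ) = v₁ at *
  rw [hl]
  generalize hS.eigenvalues₀ k₀ = l₀ at *
  generalize hS.eigenvalues₀ k₁ = l₁ at *
  -- Courant–Fischer: the span of the top two eigenvectors contains a nonzero vector orthogonal to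
  -- `√w`, that is, one corresponding to a function of mean zero. The top eigenvector need not be
  -- identified.
  obtain ⟨α, β, hαβ, hpos⟩ : ∃ α β : ℝ, α * (∑ x, √(w x) * v₀ x) + β * (∑ x, √(w x) * v₁ x) = 0
      ∧ 0 < α * α + β * β := by
    by_cases h : ∑ x, √(w x) * v₁ x = 0
    · exact ⟨0, 1, by simp [h], by norm_num⟩
    · refine ⟨∑ x, √(w x) * v₁ x, -∑ x, √(w x) * v₀ x, by ring, ?_⟩
      have := mul_self_pos.2 h
      nlinarith [mul_self_nonneg (∑ x, √(w x) * v₀ x)]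
  obtain ⟨f, hf⟩ := exists_eq_sqrt_mul hw (α • v₀ + β • v₁)
  have hmean : ∑ x, w x * f x = 0 := by
    rw [← hαβ, Finset.mul_sum, Finset.mul_sum, ← Finset.sum_add_distrib]
    refine Finset.sum_congr rfl fun x _ => ?_
    have hx := congrFun hf x
    simp only [Pi.add_apply, Pi.smul_apply, smul_eq_mul] at hx
    linear_combination √(w x) * (-hx) - f x * Real.mul_self_sqrt (hw x).le
  have h := hc f hmean
  rw [← sqrt_dotProduct_sqrt hw, ← sqrt_dotProduct_sqrt hw, ← symmetrize_mulVec hw, ← hf] at h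
  simp only [mulVec_add, mulVec_smul, h0, h1, dotProduct_add, add_dotProduct, dotProduct_smul,
    smul_dotProduct, d00, d01, d10, d11, smul_eq_mul] at h
  -- The form equals `l₀ α² + l₁ β²`, and `l₁ ≤ l₀`.
  have h' : l₁ * (α * α + β * β) ≤ c * (α * α + β * β) := by
    nlinarith [mul_self_nonneg α]
  exact le_of_mul_le_mul_right h' hpos

end WeightedSymmetric

/-! ### Collatz–Wielandt bound via Gelfand's formula. -/

section Collatz

variable {ι : Type*} [Fintype ι] [DecidableEq ι]

attribute [local instance] Matrix.linftyOpNormedRing Matrix.linftyOpNormedAlgebra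

theorem pow_smul_le_pow_mulVec {A : Matrix ι ι ℝ} (hA : ∀ i j, 0 ≤ A i j) {o : ι → ℝ} {c : ℝ}
    (hc : 0 ≤ c) (h : ∀ i, c * o i ≤ (A *ᵥ o) i) (k : ℕ) (i : ι) :
    c ^ k * o i ≤ (A ^ k *ᵥ o) i := by
  induction k generalizing i with
  | zero => simp
  | succ k ih =>
    rw [pow_succ' A, ← mulVec_mulVec]
    calc c ^ (k + 1) * o i = c ^ k * (c * o i) := by ring
      _ ≤ c ^ k * (A *ᵥ o) i := by gcongr; exact h i
      _ = ∑ j, A i j * (c ^ k * o j) := by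
        simp only [mulVec, dotProduct, Finset.mul_sum]
        exact Finset.sum_congr rfl fun j _ => by ring
      _ ≤ ∑ j, A i j * (A ^ k *ᵥ o) j := by
        gcongr with j
        · exact hA i j
        · exact ih j
      _ = (A *ᵥ (A ^ k *ᵥ o)) i := rfl

/-- The Collatz–Wielandt lower bound for the spectral radius of a nonnegative matrix. -/
theorem le_rho_of_smul_le_mulVec {A : Matrix ι ι ℝ} (hA : ∀ i j, 0 ≤ A i j) {o : ι → ℝ}
    (ho : ∀ i, 0 ≤ o i) (ho' : o ≠ 0) {c : ℝ} (hc : 0 ≤ c)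
    (h : ∀ i, c * o i ≤ (A *ᵥ o) i) : c ≤ rho A := by
  obtain ⟨i₀, hi₀⟩ := Function.ne_iff.1 ho'
  have : Nonempty ι := ⟨i₀⟩
  let M : Matrix ι ι ℂ := A.map Complex.ofReal
  let o' : ι → ℂ := fun i => (o i : ℂ)
  have hpow : ∀ k : ℕ, M ^ k *ᵥ o' = fun i => (((A ^ k *ᵥ o) i : ℝ) : ℂ) := fun k => by
    have h1 : M ^ k = (A ^ k).map Complex.ofReal := by
      have := map_pow (Complex.ofRealHom.mapMatrix (m := ι)) A k
      exact this.symm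
    ext i
    simp [h1, mulVec, dotProduct, o']
  -- Iterating the hypothesis gives `c ^ k * o ≤ A ^ k *ᵥ o` entrywise between nonnegative vectors,
  -- hence the same for sup norms; the operator norm used is the one induced by the sup norm.
  have hnorm : ∀ k : ℕ, c ^ k ≤ ‖M ^ k‖ := fun k => by
    have hpos : 0 < ‖o'‖ := norm_pos_iff.2 fun h0 => hi₀ (by
      have := congrFun h0 i₀
      simpa [o'] using this)
    refine le_of_mul_le_mul_right ?_ hpos
    refine le_trans ?_ (linfty_opNorm_mulVec (M ^ k) o')
    rw [hpow, ← abs_of_nonneg (pow_nonneg hc k), ← Real.norm_eq_abs, ← norm_smul]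
    refine (pi_norm_le_iff_of_nonneg (norm_nonneg _)).2 fun i => ?_
    refine le_trans ?_ (norm_le_pi_norm _ i)
    have := pow_smul_le_pow_mulVec hA hc h k i
    have h2 : 0 ≤ c ^ k * o i := mul_nonneg (pow_nonneg hc k) (ho i)
    simp only [o', Pi.smul_apply, norm_smul, Complex.norm_real, Real.norm_eq_abs]
    rw [abs_of_nonneg (pow_nonneg hc k), abs_of_nonneg (ho i), abs_of_nonneg (h2.trans this)]
    exact this
  have hlim := spectrum.pow_nnnorm_pow_one_div_tendsto_nhds_spectralRadius M
  have hle : ENNReal.ofReal c ≤ spectralRadius ℂ M := by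
    refine ge_of_tendsto hlim (Filter.eventually_atTop.2 ⟨1, fun k hk => ?_⟩)
    have h1 : ENNReal.ofReal c ^ k ≤ (‖M ^ k‖₊ : ENNReal) := by
      rw [← ENNReal.ofReal_pow hc, ← enorm_eq_nnnorm, ← ofReal_norm]
      exact ENNReal.ofReal_le_ofReal (hnorm k)
    calc ENNReal.ofReal c = (ENNReal.ofReal c ^ k) ^ (1 / k : ℝ) := by
          rw [one_div, ENNReal.pow_rpow_inv_natCast (by omega)]
      _ ≤ _ := ENNReal.rpow_le_rpow h1 (by positivity)
  -- Finiteness makes the `toReal` in `rho` faithful.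
  have htop : spectralRadius ℂ M ≠ ⊤ :=
    ((spectrum.spectralRadius_le_nnnorm (𝕜 := ℂ) M).trans_lt ENNReal.coe_lt_top).ne
  exact (ENNReal.ofReal_le_iff_le_toReal htop).1 hle

end Collatz

/-! ### Conditional expectations and conditional variances. -/

section CondExp

variable {ι : Type*} [Fintype ι]

open Classical in
/-- The matrix of the conditional expectation, for the distribution with weights `w`, given the
equivalence class with respect to `r`. -/
noncomputable def condExp (w : ι → ℝ) (r : Setoid ι) : Matrix ι ι ℝ :=
  Matrix.of fun x y => if r x y then w y / ∑ z, (if r x z then w z else 0) else 0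

open Classical in
theorem condExp_mass_pos {w : ι → ℝ} (hw : ∀ x, 0 < w x) (r : Setoid ι) (x : ι) :
    0 < ∑ z, (if r x z then w z else 0) :=
  Finset.sum_pos' (fun z _ => by split_ifs <;> simp [(hw z).le])
    ⟨x, Finset.mem_univ x, by simpa [Setoid.refl] using hw x⟩

theorem condExp_of_not_rel (w : ι → ℝ) {r : Setoid ι} {x y : ι} (h : ¬ r x y) :
    condExp w r x y = 0 := by
  simp [condExp, h]

theorem condExp_congr (w : ι → ℝ) {r : Setoid ι} {x y : ι} (h : r x y) :
    condExp w r x = condExp w r y := by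
  classical
  have e : (fun z => r x z) = fun z => r y z :=
    funext fun z => propext ⟨fun k => r.trans (r.symm h) k, fun k => r.trans h k⟩
  exact congrArg (fun (p : ι → Prop) z => if p z then w z / ∑ u, (if p u then w u else 0) else 0) e

theorem sum_condExp {w : ι → ℝ} (hw : ∀ x, 0 < w x) (r : Setoid ι) (x : ι) :
    ∑ y, condExp w r x y = 1 := by
  classical
  simp only [condExp, of_apply]
  rw [← div_self (condExp_mass_pos hw r x).ne', Finset.sum_div]
  exact Finset.sum_congr rfl fun y _ => by split_ifs <;> simp

theorem condExp_reversible (w : ι → ℝ) (r : Setoid ι) (x y : ι) :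
    w x * condExp w r x y = w y * condExp w r y x := by
  by_cases h : r x y
  · rw [← congrFun (condExp_congr w h) x]
    simp [condExp, h]
    ring
  · rw [condExp_of_not_rel w h, condExp_of_not_rel w fun k => h (r.symm k), mul_zero, mul_zero]

theorem condExp_mulVec_congr (w : ι → ℝ) {r : Setoid ι} {x y : ι} (h : r x y) (f : ι → ℝ) :
    (condExp w r *ᵥ f) x = (condExp w r *ᵥ f) y := by
  simp only [mulVec, condExp_congr w h]

/-- The conditional expectation at `x` only depends on the values of `f` on the class of `x`. -/
theorem condExp_mulVec_eq_of_eqOn (w : ι → ℝ) {r : Setoid ι} {x : ι} {f g : ι → ℝ}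
    (h : ∀ y, r x y → f y = g y) : (condExp w r *ᵥ f) x = (condExp w r *ᵥ g) x := by
  simp only [mulVec, dotProduct]
  refine Finset.sum_congr rfl fun y _ => ?_
  by_cases k : r x y
  · rw [h y k]
  · rw [condExp_of_not_rel w k, zero_mul, zero_mul]

theorem condExp_mulVec_const {w : ι → ℝ} (hw : ∀ x, 0 < w x) (r : Setoid ι) (a : ℝ) (x : ι) :
    (condExp w r *ᵥ fun _ => a) x = a := by
  simp only [mulVec, dotProduct, ← Finset.sum_mul, sum_condExp hw, one_mul]

theorem condExp_mulVec_of_invariant {w : ι → ℝ} (hw : ∀ x, 0 < w x) {r : Setoid ι} {x : ι}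
    {f : ι → ℝ} (h : ∀ y, r x y → f y = f x) : (condExp w r *ᵥ f) x = f x := by
  rw [condExp_mulVec_eq_of_eqOn w h, condExp_mulVec_const hw]

/-- Conditioning on less information after conditioning on more information. -/
theorem condExp_mulVec_tower {w : ι → ℝ} (hw : ∀ x, 0 < w x) {r s : Setoid ι}
    (h : ∀ x y, s x y → r x y) (f : ι → ℝ) :
    condExp w r *ᵥ (condExp w s *ᵥ f) = condExp w r *ᵥ f := by
  rw [mulVec_mulVec]
  congr 1
  ext x z
  -- Reversibility turns the sum into `condExp w s` applied to `y ↦ w x * condExp w r y x`, which is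
  -- constant on `r`-classes, hence on `s`-classes, and so is fixed.
  have hkey : w z * ∑ y, condExp w r x y * condExp w s y z = w z * condExp w r x z := by
    have h1 : ∑ y, condExp w s z y * (w x * condExp w r y x) = w x * condExp w r z x := by
      have := condExp_mulVec_of_invariant hw (r := s) (x := z) (f := fun y => w x * condExp w r y x)
        fun y hy => by rw [condExp_congr w (h z y hy)]
      exact this
    have h2 := condExp_reversible w r
    have h3 := condExp_reversible w s
    have hx := (hw x).ne'
    apply mul_left_cancel₀ hx
    calc w x * (w z * ∑ y, condExp w r x y * condExp w s y z)
        = ∑ y, (w x * condExp w r x y) * condExp w s y z * w z := by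
          simp only [Finset.mul_sum]; exact Finset.sum_congr rfl fun y _ => by ring
      _ = ∑ y, (w z * condExp w s z y) * condExp w r y x * w z := by
          refine Finset.sum_congr rfl fun y _ => ?_
          rw [h2 x y, h3 z y]; ring
      _ = (∑ y, condExp w s z y * (w x * condExp w r y x)) * w z * w z / w x := by
          rw [Finset.sum_mul, Finset.sum_mul, Finset.sum_div]
          refine Finset.sum_congr rfl fun y _ => ?_
          field_simp
      _ = w x * (w z * condExp w r x z) := by
          rw [h1]
          field_simp
          linear_combination w z * h2 z x
  exact mul_left_cancel₀ (hw z).ne' hkey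

/-- Conditioning on more information after conditioning on less information. -/
theorem condExp_mulVec_of_le {w : ι → ℝ} (hw : ∀ x, 0 < w x) {r s : Setoid ι}
    (h : ∀ x y, s x y → r x y) (f : ι → ℝ) :
    condExp w s *ᵥ (condExp w r *ᵥ f) = condExp w r *ᵥ f := by
  ext x
  exact condExp_mulVec_of_invariant hw fun y hy => (condExp_mulVec_congr w (h x y hy) f).symm

theorem sum_mul_mulVec_comm {w : ι → ℝ} {K : Matrix ι ι ℝ}
    (hK : ∀ x y, w x * K x y = w y * K y x) (f g : ι → ℝ) :
    ∑ x, w x * (f x * (K *ᵥ g) x) = ∑ x, w x * (g x * (K *ᵥ f) x) := by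
  simp only [mulVec, dotProduct, Finset.mul_sum]
  rw [Finset.sum_comm]
  refine Finset.sum_congr rfl fun y _ => Finset.sum_congr rfl fun x _ => ?_
  linear_combination f x * g y * hK x y

/-- The expected conditional variance of `f` given the class with respect to `r`. -/
noncomputable def energy (w : ι → ℝ) (r : Setoid ι) (f : ι → ℝ) : ℝ :=
  ∑ x, w x * (f x * (f x - (condExp w r *ᵥ f) x))

/-- The subtracted function is constant on the finer `s`-classes, and a conditional variance ignores
such shifts. This allows `f` to be centred before spectral bounds are applied. -/
theorem energy_sub_condExp {w : ι → ℝ} (hw : ∀ x, 0 < w x) {r s : Setoid ι}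
    (h : ∀ x y, s x y → r x y) (f : ι → ℝ) :
    energy w s (f - condExp w r *ᵥ f) = energy w s f := by
  have h1 := sum_mul_mulVec_comm (condExp_reversible w s) (condExp w r *ᵥ f) f
  rw [condExp_mulVec_of_le hw h] at h1
  unfold energy
  rw [mulVec_sub, condExp_mulVec_of_le hw h]
  simp only [Pi.sub_apply, mul_sub, sub_mul, Finset.sum_sub_distrib] at h1 ⊢
  have h2 : ∑ x, w x * ((condExp w r *ᵥ f) x * f x) = ∑ x, w x * (f x * (condExp w r *ᵥ f) x) :=
    Finset.sum_congr rfl fun x _ => by ring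
  linarith

end CondExp

/-! ### Local spectral bounds and their iteration over coordinates. -/

section LocalSpectralBound

variable {ι V κ : Type*}

/-- Two points are equivalent if the coordinates in `Λ` agree. -/
def agree (X : ι → V → κ) (Λ : Finset V) : Setoid ι where
  r x y := ∀ v ∈ Λ, X x v = X y v
  iseqv := ⟨fun _ _ _ => rfl, fun h v hv => (h v hv).symm, fun h k v hv => (h v hv).trans (k v hv)⟩

theorem agree_mono (X : ι → V → κ) {Λ Λ' : Finset V} (h : Λ ⊆ Λ') (x y : ι)
    (hxy : agree X Λ' x y) : agree X Λ x y :=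
  fun v hv => hxy v (h hv)

theorem agree_insert [DecidableEq V] (X : ι → V → κ) {Λ : Finset V} {u : V} {x y : ι} (h : agree X Λ x y)
    (hu : X x u = X y u) : agree X (insert u Λ) x y := by
  intro v hv
  rcases Finset.mem_insert.1 hv with rfl | hv
  · exact hu
  · exact h v hv

theorem energy_agree_empty [Fintype ι] {w : ι → ℝ} (X : ι → V → κ) {f : ι → ℝ}
    (hf : ∑ x, w x * f x = 0) : energy w (agree X ∅) f = ∑ x, w x * (f x * f x) := by
  have h : condExp w (agree X ∅) *ᵥ f = 0 := by
    ext x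
    have hr : ∀ y, agree X ∅ x y := fun y v hv => absurd hv (Finset.notMem_empty v)
    simp only [mulVec, dotProduct, condExp, of_apply, hr, if_true, div_mul_eq_mul_div,
      ← Finset.sum_div, hf, zero_div, Pi.zero_apply]
  simp only [energy, h, Pi.zero_apply, sub_zero]

/-- A signed measure `d` of total mass zero, carried by `C`, integrates a function of `φ` to at
most the total variation of its image under `φ`, times the oscillation of the function on `C`. -/
theorem sum_mul_le_tv_mul_osc [Fintype ι] [Fintype κ] [DecidableEq κ] {d : ι → ℝ}
    (hd : ∑ z, d z = 0) {C : Set ι}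
    (hC : ∀ z, z ∉ C → d z = 0) (φ : ι → κ) {g : ι → ℝ}
    (hg : ∀ z ∈ C, ∀ z' ∈ C, φ z = φ z' → g z = g z') {a b : ℝ}
    (ha : ∀ z ∈ C, g z ≤ a) (hb : ∀ z ∈ C, b ≤ g z) (hab : b ≤ a) :
    ∑ z, d z * g z ≤ (1 / 2 * ∑ c, |∑ z, d z * if φ z = c then 1 else 0|) * (a - b) := by
  -- Centring at the midpoint is free because `d` has total mass zero; it bounds the integrand by
  -- `(a - b) / 2`, whence the `1 / 2` of total variation.
  have h1 : ∑ z, d z * g z = ∑ z, d z * (g z - (a + b) / 2) := by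
    simp only [mul_sub, Finset.sum_sub_distrib, ← Finset.sum_mul, hd]
    ring
  rw [h1, ← Finset.sum_fiberwise _ φ, mul_comm (1 / 2 : ℝ), mul_assoc, Finset.sum_mul]
  refine Finset.sum_le_sum fun c _ => ?_
  obtain ⟨h, hh, hgh⟩ : ∃ h : ℝ, |h| ≤ 1 / 2 * (a - b) ∧
      ∀ z ∈ C, φ z = c → g z - (a + b) / 2 = h := by
    by_cases hz : ∃ z ∈ C, φ z = c
    · obtain ⟨z, hz, hzc⟩ := hz
      refine ⟨g z - (a + b) / 2, ?_, fun z' hz' hc => by rw [hg z' hz' z hz (hc.trans hzc.symm)]⟩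
      rw [abs_le]
      constructor <;> linarith [ha z hz, hb z hz]
    · exact ⟨0, by rw [abs_zero]; linarith, fun z h1 h2 => absurd ⟨z, h1, h2⟩ hz⟩
  have h2 : ∑ z with φ z = c, d z * (g z - (a + b) / 2)
      = (∑ z, d z * if φ z = c then 1 else 0) * h := by
    rw [Finset.sum_filter, Finset.sum_mul]
    refine Finset.sum_congr rfl fun z _ => ?_
    by_cases hz : z ∈ C
    · by_cases hc : φ z = c
      · simp [hc, hgh z hz hc]
      · simp [hc]
    · simp [hC z hz]
  rw [h2]
  refine (le_abs_self _).trans ?_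
  rw [abs_mul]
  exact mul_le_mul_of_nonneg_left hh (abs_nonneg _)

/-- If the matrices `Ψ x` dominate the pairwise influences given the coordinates in `Λ`, and have
spectral radius at most `η`, then the centred sum of the conditional expectations given
one more coordinate has no eigenvalue above `1 + η`. -/
theorem eigenvalue_sum_condExp_le [Fintype ι] [Fintype V] [DecidableEq V] [Fintype κ]
    [DecidableEq κ] {w : ι → ℝ} (hw : ∀ x, 0 < w x) (X : ι → V → κ) (Λ : Finset V)
    {Ψ : ι → Matrix {v : V // v ∉ Λ} {v : V // v ∉ Λ} ℝ} (hΨ₀ : ∀ x u v, 0 ≤ Ψ x u v)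
    (hΨ : ∀ x₀ x y, agree X Λ x₀ x → agree X Λ x₀ y → ∀ u v : {v : V // v ∉ Λ}, u ≠ v →
      1 / 2 * ∑ c, |(condExp w (agree X (insert u.1 Λ)) *ᵥ fun z => if X z v = c then 1 else 0) x
        - (condExp w (agree X (insert u.1 Λ)) *ᵥ fun z => if X z v = c then 1 else 0) y|
      ≤ Ψ x₀ u v)
    {η : ℝ} (hη : 0 ≤ η) (hρ : ∀ x, rho (Ψ x) ≤ η) {t : ℝ} {f : ι → ℝ} (hf : f ≠ 0)
    (h : (∑ u : {v : V // v ∉ Λ}, condExp w (agree X (insert u.1 Λ))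
      - (Fintype.card {v : V // v ∉ Λ} : ℝ) • condExp w (agree X Λ)) *ᵥ f = t • f) :
    t ≤ 1 + η := by
  by_contra! ht
  have hsub : ∀ u : {v : V // v ∉ Λ}, ∀ x y, agree X (insert u.1 Λ) x y → agree X Λ x y :=
    fun u => agree_mono X (Finset.subset_insert _ _)
  have ht0 : t ≠ 0 := by linarith
  rw [sub_mulVec, sum_mulVec, smul_mulVec] at h
  -- By the tower property `E_Λ` annihilates the left side of the eigenvalue equation, and `t ≠ 0`.
  have hA : condExp w (agree X Λ) *ᵥ f = 0 := by
    have h1 := congrArg (condExp w (agree X Λ) *ᵥ ·) h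
    simp only [mulVec_sub, mulVec_sum, mulVec_smul, condExp_mulVec_tower hw (hsub _),
      condExp_mulVec_tower hw (fun _ _ k => k), Finset.sum_const, Finset.card_univ,
      Nat.cast_smul_eq_nsmul, sub_self] at h1
    exact (smul_eq_zero.1 h1.symm).resolve_left ht0
  rw [hA, smul_zero, sub_zero] at h
  obtain ⟨x₀, hx₀⟩ := Function.ne_iff.1 hf
  let B : {v : V // v ∉ Λ} → Matrix ι ι ℝ := fun u => condExp w (agree X (insert u.1 Λ))
  let g : {v : V // v ∉ Λ} → ι → ℝ := fun u => B u *ᵥ f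
  have hg : ∀ u x y, agree X (insert u.1 Λ) x y → g u x = g u y :=
    fun u x y k => condExp_mulVec_congr w k f
  have hBB : ∀ u, B u *ᵥ g u = g u := fun u => condExp_mulVec_tower hw (fun _ _ k => k) f
  have htg : ∀ u x, t * g u x = ∑ v, (B u *ᵥ g v) x := fun u x => by
    have := congrFun (congrArg (B u *ᵥ ·) h) x
    simp only [mulVec_sum, mulVec_smul, Finset.sum_apply, Pi.smul_apply, smul_eq_mul] at this
    exact this.symm
  -- The fibre is taken through a point where `f x₀ ≠ 0`; this is what makes `o` nonzero below.
  let C : Set ι := {x | agree X Λ x₀ x}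
  have hx₀C : x₀ ∈ C := (agree X Λ).refl x₀
  choose a haC ha using fun u => Set.exists_max_image C (g u) C.toFinite ⟨x₀, hx₀C⟩
  choose b hbC hb using fun u => Set.exists_min_image C (g u) C.toFinite ⟨x₀, hx₀C⟩
  let o : {v : V // v ∉ Λ} → ℝ := fun u => g u (a u) - g u (b u)
  have ho : ∀ u, 0 ≤ o u := fun u => sub_nonneg.2 (hb u _ (haC u))
  have hcontr : ∀ u v, u ≠ v → ∀ x ∈ C, ∀ y ∈ C,
      (B u *ᵥ g v) x - (B u *ᵥ g v) y ≤ Ψ x₀ u v * o v := by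
    intro u v huv x hx y hy
    have key := sum_mul_le_tv_mul_osc (d := fun z => B u x z - B u y z) (C := C)
      (by simp only [Finset.sum_sub_distrib, B, sum_condExp hw, sub_self])
      (fun z hz => by
        have h1 : B u x z = 0 := condExp_of_not_rel w fun k =>
          hz ((agree X Λ).trans hx (hsub u _ _ k))
        have h2 : B u y z = 0 := condExp_of_not_rel w fun k =>
          hz ((agree X Λ).trans hy (hsub u _ _ k))
        rw [h1, h2, sub_zero])
      (fun z => X z v)
      (fun z hz z' hz' k => hg v z z' (agree_insert X ((agree X Λ).trans
        ((agree X Λ).symm hz) hz') k)) (ha v) (hb v) (hb v _ (haC v))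
    have h1 : (B u *ᵥ g v) x - (B u *ᵥ g v) y = ∑ z, (B u x z - B u y z) * g v z := by
      simp only [mulVec, dotProduct, sub_mul, Finset.sum_sub_distrib]
    rw [h1]
    refine key.trans (mul_le_mul_of_nonneg_right ?_ (ho v))
    refine le_trans (le_of_eq ?_) (hΨ x₀ x y hx hy u v huv)
    simp only [mulVec, dotProduct, sub_mul, Finset.sum_sub_distrib, B]
  -- The term `v = u` contributes exactly `o u`, since `B u` fixes `g u`; this accounts for the `1`
  -- in `1 + η`.
  have hosc : ∀ u, (t - 1) * o u ≤ (Ψ x₀ *ᵥ o) u := by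
    intro u
    have h1 : t * o u = ∑ v, ((B u *ᵥ g v) (a u) - (B u *ᵥ g v) (b u)) := by
      rw [Finset.sum_sub_distrib, ← htg, ← htg, mul_sub]
    have h2 : ∑ v, ((B u *ᵥ g v) (a u) - (B u *ᵥ g v) (b u))
        ≤ ∑ v, (Ψ x₀ u v * o v + if u = v then o u else 0) := by
      refine Finset.sum_le_sum fun v _ => ?_
      by_cases huv : u = v
      · subst huv
        rw [hBB, if_pos rfl]
        exact le_add_of_nonneg_left (mul_nonneg (hΨ₀ _ _ _) (ho u))
      · rw [if_neg huv, add_zero]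
        exact hcontr u v huv _ (haC u) _ (hbC u)
    rw [Finset.sum_add_distrib, Finset.sum_ite_eq, if_pos (Finset.mem_univ u)] at h2
    have h3 : (Ψ x₀ *ᵥ o) u = ∑ v, Ψ x₀ u v * o v := rfl
    linarith
  -- If all oscillations vanish, each `g u` is constant on the fibre and equals its conditional mean
  -- there, which is `0`; then `t * f x₀ = 0`.
  have hone : o ≠ 0 := by
    intro ho0
    have hgz : ∀ u, g u x₀ = 0 := fun u => by
      have hu : g u (a u) - g u (b u) = 0 := congrFun ho0 u
      have h1 : (condExp w (agree X Λ) *ᵥ g u) x₀ = g u x₀ :=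
        condExp_mulVec_of_invariant hw fun y hy => by
          linarith [ha u y hy, hb u y hy, ha u x₀ hx₀C, hb u x₀ hx₀C]
      rw [← h1]
      exact congrFun ((condExp_mulVec_tower hw (hsub u) f).trans hA) x₀
    have h1 := congrFun h x₀
    simp only [Finset.sum_apply, Pi.smul_apply, smul_eq_mul] at h1
    rw [Finset.sum_eq_zero fun u _ => hgz u] at h1
    exact (mul_ne_zero ht0 hx₀) h1.symm
  have := le_rho_of_smul_le_mulVec (hΨ₀ x₀) ho hone (by linarith) hosc
  linarith [hρ x₀]

/-- The one-step local-to-global inequality for conditional variances. -/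
theorem sub_mul_energy_le_sum_energy_insert [Fintype ι] [DecidableEq ι] [Fintype V]
    [DecidableEq V] {w : ι → ℝ} (hw : ∀ x, 0 < w x) (X : ι → V → κ) (Λ : Finset V) {η : ℝ}
    (h : ∀ (t : ℝ) (f : ι → ℝ), f ≠ 0 →
      (∑ u : {v : V // v ∉ Λ}, condExp w (agree X (insert u.1 Λ))
        - (Fintype.card {v : V // v ∉ Λ} : ℝ) • condExp w (agree X Λ)) *ᵥ f = t • f → t ≤ 1 + η)
    (f : ι → ℝ) :
    ((Fintype.card {v : V // v ∉ Λ} : ℝ) - 1 - η) * energy w (agree X Λ) f ≤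
      ∑ u : {v : V // v ∉ Λ}, energy w (agree X (insert u.1 Λ)) f := by
  have hsub : ∀ u : {v : V // v ∉ Λ}, ∀ x y, agree X (insert u.1 Λ) x y → agree X Λ x y :=
    fun u => agree_mono X (Finset.subset_insert _ _)
  -- After centring, the term `card • E_Λ` acts as zero. Its purpose is to remove the functions of
  -- `X_Λ`, on which the sum alone has eigenvalue `card`, so that the eigenvalue bound holds on the
  -- whole space.
  rw [← energy_sub_condExp hw (fun _ _ k => k) f]
  simp only [← energy_sub_condExp hw (hsub _) f]
  have hA : condExp w (agree X Λ) *ᵥ (f - condExp w (agree X Λ) *ᵥ f) = 0 := by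
    rw [mulVec_sub, condExp_mulVec_tower hw (fun _ _ k => k), sub_self]
  generalize f - condExp w (agree X Λ) *ᵥ f = g at hA
  have key := form_le_of_eigenvalue_le hw (fun x y => by
    simp only [Matrix.sub_apply, Matrix.sum_apply, Matrix.smul_apply, smul_eq_mul, mul_sub,
      Finset.mul_sum]
    congr 1
    · exact Finset.sum_congr rfl fun u _ => condExp_reversible w _ x y
    · linear_combination (Fintype.card {v : V // v ∉ Λ} : ℝ)
        * condExp_reversible w (agree X Λ) x y) h g
  rw [sub_mulVec, sum_mulVec, smul_mulVec, hA, smul_zero, sub_zero] at key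
  have h1 : ∑ x, w x * (g x * (∑ u : {v : V // v ∉ Λ},
      condExp w (agree X (insert u.1 Λ)) *ᵥ g) x)
      = ∑ u : {v : V // v ∉ Λ}, ∑ x, w x * (g x * (condExp w (agree X (insert u.1 Λ)) *ᵥ g) x) := by
    rw [Finset.sum_comm]
    exact Finset.sum_congr rfl fun x _ => by simp only [Finset.sum_apply, Finset.mul_sum]
  rw [h1] at key
  simp only [energy, hA, Pi.zero_apply, sub_zero, mul_sub, Finset.sum_sub_distrib,
    Finset.sum_const, Finset.card_univ, nsmul_eq_mul]
  linarith

/-- Iterating the one-step inequality: the conditional variance given `Λ` is controlled by the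
sum of the conditional variances given all coordinates but one. -/
theorem prod_mul_energy_le [Fintype ι] [Fintype V] [DecidableEq V] {w : ι → ℝ} (X : ι → V → κ)
    {η : ℕ → ℝ}
    (hη : ∀ k, k + 2 ≤ Fintype.card V → η k < (Fintype.card V : ℝ) - k - 1) (f : ι → ℝ)
    (h : ∀ Λ : Finset V, Λ.card + 2 ≤ Fintype.card V →
      ((Fintype.card {v : V // v ∉ Λ} : ℝ) - 1 - η Λ.card) * energy w (agree X Λ) f ≤
        ∑ u : {v : V // v ∉ Λ}, energy w (agree X (insert u.1 Λ)) f)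
    (Λ : Finset V) (hΛ : Λ.card + 1 ≤ Fintype.card V) :
    (∏ k ∈ Finset.Ico Λ.card (Fintype.card V - 1), (1 - η k / ((Fintype.card V : ℝ) - k - 1)))
      * energy w (agree X Λ) f ≤ ∑ v ∈ Λᶜ, energy w (agree X (Finset.univ.erase v)) f := by
  induction hm : Fintype.card V - Λ.card generalizing Λ with
  | zero => omega
  | succ m ih =>
    rcases Nat.eq_zero_or_pos m with rfl | hm0
    -- Base case: one coordinate is left free, the product is empty and both sides are the same
    -- energy.
    · have hc : Λᶜ.card = 1 := by rw [Finset.card_compl]; omega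
      obtain ⟨v, hv⟩ := Finset.card_eq_one.1 hc
      have hΛv : Λ = Finset.univ.erase v := by
        rw [← compl_compl Λ, hv, Finset.erase_eq, Finset.compl_eq_univ_sdiff]
      rw [Finset.Ico_eq_empty (by omega), Finset.prod_empty, one_mul, hv, Finset.sum_singleton,
        ← hΛv]
    · have hΛ2 : Λ.card + 2 ≤ Fintype.card V := by omega
      have hcard : (Fintype.card {v : V // v ∉ Λ} : ℝ) = m + 1 := by
        have : Fintype.card {v : V // v ∉ Λ} = m + 1 := by
          rw [Fintype.card_subtype_compl, Fintype.card_coe]; exact hm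
        exact_mod_cast this
      have hV : (Fintype.card V : ℝ) = Λ.card + m + 1 := by
        have : Fintype.card V = Λ.card + m + 1 := by omega
        exact_mod_cast this
      set Q := ∏ k ∈ Finset.Ico (Λ.card + 1) (Fintype.card V - 1),
        (1 - η k / ((Fintype.card V : ℝ) - k - 1)) with hQ
      -- The sign of the later factors is where `η k < n - k - 1` is needed: the one-step inequality
      -- gets multiplied by `Q`.
      have hQ0 : 0 ≤ Q := Finset.prod_nonneg fun k hk => by
        have hk' := Finset.mem_Ico.1 hk
        have h1 := hη k (by omega)
        have h2 : (0 : ℝ) < (Fintype.card V : ℝ) - k - 1 := by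
          have : ((k + 2 : ℕ) : ℝ) ≤ Fintype.card V := by exact_mod_cast (by omega)
          push_cast at this
          linarith
        rw [sub_nonneg, div_le_one h2]
        exact h1.le
      have hm0' : (0 : ℝ) < m := by exact_mod_cast hm0
      have hstep := h Λ hΛ2
      have hind : ∀ u : {v : V // v ∉ Λ}, Q * energy w (agree X (insert u.1 Λ)) f ≤
          ∑ v ∈ (insert u.1 Λ)ᶜ, energy w (agree X (Finset.univ.erase v)) f := fun u => by
        have hi : (insert u.1 Λ).card = Λ.card + 1 := Finset.card_insert_of_notMem u.2
        have := ih (insert u.1 Λ) (by omega) (by omega)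
        rwa [hi] at this
      -- Double counting: each `v ∉ Λ` is missed only by `u = v`, so it occurs for `m` of the `m +
      -- 1` choices of `u`.
      have hsum : ∑ u : {v : V // v ∉ Λ},
          ∑ v ∈ (insert u.1 Λ)ᶜ, energy w (agree X (Finset.univ.erase v)) f
          = m * ∑ v ∈ Λᶜ, energy w (agree X (Finset.univ.erase v)) f := by
        have h1 : ∀ u : {v : V // v ∉ Λ},
            ∑ v ∈ (insert u.1 Λ)ᶜ, energy w (agree X (Finset.univ.erase v)) f
            = ∑ v ∈ Λᶜ, energy w (agree X (Finset.univ.erase v)) f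
              - energy w (agree X (Finset.univ.erase u.1)) f := fun u => by
          rw [Finset.compl_insert, ← Finset.sum_erase_add _ _ (Finset.mem_compl.2 u.2),
            add_sub_cancel_right]
        have h2 : ∑ u : {v : V // v ∉ Λ}, energy w (agree X (Finset.univ.erase u.1)) f
            = ∑ v ∈ Λᶜ, energy w (agree X (Finset.univ.erase v)) f :=
          (Finset.sum_subtype Λᶜ (fun v => Finset.mem_compl)
            fun v => energy w (agree X (Finset.univ.erase v)) f).symm
        rw [Finset.sum_congr rfl fun u _ => h1 u, Finset.sum_sub_distrib, h2, Finset.sum_const,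
          Finset.card_univ, nsmul_eq_mul, hcard]
        ring
      rw [Finset.prod_eq_prod_Ico_succ_bot (by omega), ← hQ]
      have hγ : (1 - η Λ.card / ((Fintype.card V : ℝ) - Λ.card - 1)) * m
          = (Fintype.card {v : V // v ∉ Λ} : ℝ) - 1 - η Λ.card := by
        have : (Fintype.card V : ℝ) - Λ.card - 1 = m := by rw [hV]; ring
        rw [this, hcard]
        field_simp
        ring
      refine le_of_mul_le_mul_left ?_ hm0'
      rw [← hsum]
      calc _ = Q * (((Fintype.card {v : V // v ∉ Λ} : ℝ) - 1 - η Λ.card)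
            * energy w (agree X Λ) f) := by rw [← hγ]; ring
        _ ≤ Q * ∑ u : {v : V // v ∉ Λ}, energy w (agree X (insert u.1 Λ)) f := by gcongr
        _ ≤ _ := by rw [Finset.mul_sum]; exact Finset.sum_le_sum fun u _ => hind u

end LocalSpectralBound

/-! ### Translation to the distribution `μ` and its Glauber dynamics. -/

section Glauber

variable {V : Type*} [Fintype V] {q : ℕ} {μ : Config V q → ℝ}

/-- The values of the variables as functions on the support. -/
abbrev coords (μ : Config V q → ℝ) : Supp μ → V → Fin q := Subtype.val

/-- The mass function on the support. -/
abbrev mass (μ : Config V q → ℝ) (x : Supp μ) : ℝ := μ x.1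

variable [DecidableEq V]

open Classical in
theorem prob_eq_sum_supp (hμ : ∀ τ, 0 ≤ μ τ) (E : Set (Config V q)) :
    prob μ E = ∑ x : Supp μ, if x.1 ∈ E then μ x.1 else 0 := by
  rw [prob, ← Finset.sum_filter_of_ne (p := fun τ => 0 < μ τ) fun τ _ hτ =>
    lt_of_le_of_ne (hμ τ) fun h => hτ (by simp [Set.indicator_apply, ← h])]
  exact Finset.sum_subtype _ (by simp) _

theorem prob_pos (hμ : ∀ τ, 0 ≤ μ τ) {E : Set (Config V q)} {x : Supp μ} (hx : x.1 ∈ E) :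
    0 < prob μ E :=
  Finset.sum_pos' (fun τ _ => Set.indicator_nonneg (fun τ _ => hμ τ) τ)
    ⟨x.1, Finset.mem_univ _, by rw [Set.indicator_of_mem hx]; exact x.2⟩

theorem condMarginal_eq_condExp (hμ : ∀ τ, 0 ≤ μ τ) {E : Set (Config V q)} {r : Setoid (Supp μ)}
    {x : Supp μ} (hE : ∀ y : Supp μ, y.1 ∈ E ↔ r x y) (v : V) (c : Fin q) :
    condMarginal μ E v c =
      (condExp (mass μ) r *ᵥ fun z => if coords μ z v = c then 1 else 0) x := by
  classical
  rw [condMarginal, prob_eq_sum_supp hμ, prob_eq_sum_supp hμ, Finset.sum_div]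
  refine Finset.sum_congr rfl fun y _ => ?_
  simp only [condExp, of_apply, hE, Set.mem_inter_iff, Set.mem_ofPred_eq]
  by_cases h1 : r x y <;> by_cases h2 : y.1 v = c <;> simp [h1, h2]

theorem tvDist_nonneg (p p' : Fin q → ℝ) : 0 ≤ tvDist p p' :=
  mul_nonneg (by norm_num) (Finset.sum_nonneg fun _ _ => abs_nonneg _)

theorem influenceMatrix_nonneg {Λ : Finset V} (σ : Λ → Fin q) (u v : {v : V // v ∉ Λ}) :
    0 ≤ influenceMatrix μ σ u v := by
  simp only [influenceMatrix, of_apply]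
  split_ifs
  · rfl
  · exact Real.iSup_nonneg fun _ => tvDist_nonneg _ _

theorem tvDist_le_influenceMatrix {Λ : Finset V} {σ : Λ → Fin q} {u v : {v : V // v ∉ Λ}}
    (huv : u ≠ v) {i j : Fin q} (hi : i ∈ possibleValues μ σ u.1)
    (hj : j ∈ possibleValues μ σ u.1) :
    tvDist (condMarginal μ (cylinder σ ∩ {τ | τ u.1 = i}) v.1)
      (condMarginal μ (cylinder σ ∩ {τ | τ u.1 = j}) v.1) ≤ influenceMatrix μ σ u v := by
  simp only [influenceMatrix, of_apply, if_neg huv]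
  exact le_ciSup (f := fun p : possibleValues μ σ u.1 × possibleValues μ σ u.1 =>
    tvDist (condMarginal μ (cylinder σ ∩ {τ | τ u.1 = p.1.1}) v.1)
      (condMarginal μ (cylinder σ ∩ {τ | τ u.1 = p.2.1}) v.1))
    (Set.finite_range _).bddAbove (⟨i, hi⟩, ⟨j, hj⟩)

/-- Pinning `X_Λ` as in `x₀` and `X_u` as in `x` selects the `agree`-class of `x`, and the values of
`u` at support points of the fibre are possible ones. The distance is therefore among those
maximised in the influence matrix. -/
theorem tv_condExp_le_influenceMatrix (hμ : ∀ τ, 0 ≤ μ τ) {Λ : Finset V} {x₀ x y : Supp μ}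
    (hx : agree (coords μ) Λ x₀ x) (hy : agree (coords μ) Λ x₀ y) {u v : {v : V // v ∉ Λ}}
    (huv : u ≠ v) :
    1 / 2 * ∑ c, |(condExp (mass μ) (agree (coords μ) (insert u.1 Λ)) *ᵥ
          fun z => if coords μ z v = c then 1 else 0) x
        - (condExp (mass μ) (agree (coords μ) (insert u.1 Λ)) *ᵥ
          fun z => if coords μ z v = c then 1 else 0) y|
      ≤ influenceMatrix μ (fun a : Λ => x₀.1 a.1) u v := by
  have hcyl : ∀ {z : Supp μ}, agree (coords μ) Λ x₀ z →
      z.1 ∈ cylinder (fun a : Λ => x₀.1 a.1) := fun h a => (h a.1 a.2).symm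
  have hpos : ∀ {z : Supp μ}, agree (coords μ) Λ x₀ z →
      z.1 u.1 ∈ possibleValues μ (fun a : Λ => x₀.1 a.1) u.1 := fun {z} h =>
    div_pos (prob_pos hμ (E := _ ∩ {τ | τ u.1 = z.1 u.1}) (x := z) ⟨hcyl h, rfl⟩)
      (prob_pos hμ (x := z) (hcyl h))
  have hE : ∀ {z : Supp μ}, agree (coords μ) Λ x₀ z → ∀ z' : Supp μ,
      z'.1 ∈ cylinder (fun a : Λ => x₀.1 a.1) ∩ {τ | τ u.1 = z.1 u.1} ↔
        agree (coords μ) (insert u.1 Λ) z z' := by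
    intro z h z'
    constructor
    · rintro ⟨h1, h2⟩
      exact agree_insert _ (fun a ha => (h a ha).symm.trans (h1 ⟨a, ha⟩).symm) h2.symm
    · intro h1
      exact ⟨fun a => ((h a.1 a.2).trans (h1 a.1 (Finset.mem_insert_of_mem a.2))).symm,
        (h1 u.1 (Finset.mem_insert_self _ _)).symm⟩
  have := tvDist_le_influenceMatrix huv (hpos hx) (hpos hy)
  simpa only [tvDist, condMarginal_eq_condExp hμ (hE hx), condMarginal_eq_condExp hμ (hE hy)]
    using this

theorem glauber_eq_sum_condExp (hμ : ∀ τ, 0 ≤ μ τ) :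
    glauber μ = (1 / (Fintype.card V : ℝ)) •
      ∑ v : V, condExp (mass μ) (agree (coords μ) (Finset.univ.erase v)) := by
  ext x y
  simp only [glauber, of_apply, Matrix.smul_apply, Matrix.sum_apply, smul_eq_mul]
  congr 1
  refine Finset.sum_congr rfl fun v _ => ?_
  have hE : ∀ z : Supp μ, (z.1 ∈ {τ : Config V q | ∀ u, u ≠ v → τ u = x.1 u}) ↔
      agree (coords μ) (Finset.univ.erase v) x z := fun z =>
    ⟨fun h u hu => (h u (Finset.ne_of_mem_erase hu)).symm,
      fun h u hu => (h u (Finset.mem_erase.2 ⟨hu, Finset.mem_univ u⟩)).symm⟩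
  split_ifs with h
  · have hxy := (hE y).1 h
    -- Only `z = y` contributes: a `z` in the class of `x` agrees with `y` off `v`, and the
    -- indicator forces agreement at `v`.
    rw [condMarginal_eq_condExp hμ hE, mulVec, dotProduct,
      Finset.sum_eq_single_of_mem y (Finset.mem_univ y)]
    · simp
    · intro z _ hz
      by_cases hxz : agree (coords μ) (Finset.univ.erase v) x z
      · rw [if_neg, mul_zero]
        intro hv
        refine hz (Subtype.ext (funext fun u => ?_))
        by_cases hu : u = v
        · rw [hu]; exact hv
        · have hu' := Finset.mem_erase.2 ⟨hu, Finset.mem_univ u⟩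
          exact (hxz u hu').symm.trans (hxy u hu')
      · rw [condExp_of_not_rel _ hxz, zero_mul]
  · exact (condExp_of_not_rel _ fun k => h ((hE y).2 k)).symm

theorem glauber_reversible (hμ : ∀ τ, 0 ≤ μ τ) (x y : Supp μ) :
    mass μ x * glauber μ x y = mass μ y * glauber μ y x := by
  simp only [glauber_eq_sum_condExp hμ, Matrix.smul_apply, Matrix.sum_apply, smul_eq_mul,
    Finset.mul_sum]
  refine Finset.sum_congr rfl fun v _ => ?_
  linear_combination (1 / (Fintype.card V : ℝ)) *
    condExp_reversible (mass μ) (agree (coords μ) (Finset.univ.erase v)) x y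

/-- Each energy is `⟨f, f⟩ - ⟨f, E_{V∖v} f⟩`, and averaging over `v` turns the second term into the
Glauber form. -/
theorem sum_mul_glauber (hμ : ∀ τ, 0 ≤ μ τ) (hV : Fintype.card V ≠ 0) (f : Supp μ → ℝ) :
    ∑ x, mass μ x * (f x * (glauber μ *ᵥ f) x) = ∑ x, mass μ x * (f x * f x)
      - 1 / (Fintype.card V : ℝ) *
        ∑ v : V, energy (mass μ) (agree (coords μ) (Finset.univ.erase v)) f := by
  have hV' : (Fintype.card V : ℝ) ≠ 0 := by exact_mod_cast hV
  have h1 : ∑ x, mass μ x * (f x * (glauber μ *ᵥ f) x) = 1 / (Fintype.card V : ℝ) *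
      ∑ v : V, ∑ x, mass μ x *
        (f x * (condExp (mass μ) (agree (coords μ) (Finset.univ.erase v)) *ᵥ f) x) := by
    rw [glauber_eq_sum_condExp hμ, smul_mulVec, sum_mulVec, Finset.sum_comm, Finset.mul_sum]
    refine Finset.sum_congr rfl fun x _ => ?_
    simp only [Pi.smul_apply, Finset.sum_apply, smul_eq_mul, Finset.mul_sum]
    exact Finset.sum_congr rfl fun v _ => by ring
  rw [h1]
  simp only [energy, mul_sub, Finset.sum_sub_distrib, Finset.sum_const, Finset.card_univ,
    nsmul_eq_mul]
  field_simp
  ring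

/-- Under spectral independence, the Glauber dynamics satisfies a Poincaré inequality. -/
theorem glauber_form_le (hμ₀ : ∀ τ, 0 ≤ μ τ) (hV : Fintype.card V ≠ 0) {η : ℕ → ℝ}
    (hη : ∀ k : ℕ, k + 2 ≤ Fintype.card V →
      0 ≤ η k ∧ η k < (Fintype.card V : ℝ) - (k : ℝ) - 1)
    (hSI : IsSpectrallyIndependent μ η) (f : Supp μ → ℝ) (hf : ∑ x, mass μ x * f x = 0) :
    ∑ x, mass μ x * (f x * (glauber μ *ᵥ f) x) ≤
      (1 - (1 / (Fintype.card V : ℝ)) * ∏ k ∈ Finset.range (Fintype.card V - 1),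
        (1 - η k / ((Fintype.card V : ℝ) - (k : ℝ) - 1))) * ∑ x, mass μ x * (f x * f x) := by
  have hw : ∀ x : Supp μ, 0 < mass μ x := fun x => x.2
  have hone : ∀ (Λ : Finset V), Λ.card + 2 ≤ Fintype.card V →
      ((Fintype.card {v : V // v ∉ Λ} : ℝ) - 1 - η Λ.card) * energy (mass μ) (agree (coords μ) Λ) f
        ≤ ∑ u : {v : V // v ∉ Λ}, energy (mass μ) (agree (coords μ) (insert u.1 Λ)) f :=
    fun Λ hΛ => sub_mul_energy_le_sum_energy_insert hw (coords μ) Λ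
      (fun t g hg h => eigenvalue_sum_condExp_le hw (coords μ) Λ
        (Ψ := fun x => influenceMatrix μ (fun a : Λ => x.1 a.1))
        (fun x => influenceMatrix_nonneg _)
        (fun x₀ x y hx hy u v huv => tv_condExp_le_influenceMatrix hμ₀ hx hy huv)
        (hη _ hΛ).1 (fun x => hSI _ hΛ Λ rfl _ ⟨x.1, fun _ => rfl, x.2⟩) hg h) f
  have h := prod_mul_energy_le (coords μ) (fun k hk => (hη k hk).2) f hone ∅
    (by simp; omega)
  rw [energy_agree_empty _ hf, Finset.card_empty, Nat.Ico_zero_eq_range, Finset.compl_empty] at h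
  rw [sum_mul_glauber hμ₀ hV, sub_mul, one_mul, mul_assoc]
  gcongr

end Glauber

end SpectralIndependence

theorem theorem3p2 {V : Type*} [Fintype V] [DecidableEq V] {q : ℕ}
    (μ : SpectralIndependence.Config V q → ℝ)
    (hμ : μ ∈ stdSimplex ℝ (SpectralIndependence.Config V q))
    (hΩ : 2 ≤ Fintype.card (SpectralIndependence.Supp μ))
    (η : ℕ → ℝ)
    (hη : ∀ k : ℕ, k + 2 ≤ Fintype.card V →
      0 ≤ η k ∧ η k < (Fintype.card V : ℝ) - (k : ℝ) - 1)
    (hSI : SpectralIndependence.IsSpectrallyIndependent μ η) :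
    (SpectralIndependence.glauber μ).charpoly.Splits ∧
      1 - SpectralIndependence.lambda2 (SpectralIndependence.glauber μ) ≥
        (1 / (Fintype.card V : ℝ)) *
          ∏ k ∈ Finset.range (Fintype.card V - 1),
            (1 - η k / ((Fintype.card V : ℝ) - (k : ℝ) - 1)) := by
  have hμ₀ : ∀ τ, 0 ≤ μ τ := hμ.1
  -- On an empty `V` there is a single configuration, contradicting the two support points.
  have hV : Fintype.card V ≠ 0 := fun h => by
    have := Fintype.card_eq_zero_iff.1 h
    have := Fintype.card_le_one_iff_subsingleton.2
      (inferInstance : Subsingleton (SpectralIndependence.Supp μ))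
    omega
  obtain ⟨h1, h2⟩ := SpectralIndependence.lambda2_le_of_form_le (fun x => x.2)
    (SpectralIndependence.glauber_reversible hμ₀) hΩ
    (SpectralIndependence.glauber_form_le hμ₀ hV hη hSI)
  exact ⟨h1, by linarith⟩
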